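/- Let $H$ be a real Hilbert space with closed unit ball $\mathbb B$, let $T>0$, and let $C\subset H$ be ball-compact, i.e. $C\cap r\mathbb B$ is compact for every $r>0$ (so $C$ is closed). Write $d(x,S)=\inf_{z\in S}\|x-z\|$, and for $\varepsilon>0$ let $\operatorname{proj}_S^{\varepsilon}(x)=\{z\in S:\|x-z\|^2<d(x,S)^2+\varepsilon\}$. Let $N(C;x)$ be the Clarke normal cone: for $x\in C$ it is the set of $v\in H$ with $\langle v,w\rangle\le 0$ for all $w$ in the Clarke tangent cone of $C$ at $x$ (the set of $w$ such that for all sequences $y_n\in C$, $y_n\to x$, and $\tau_n>0$, $\tau_n\to0$, there are $w_n\to w$ with $y_n+\tau_nw_n\in C$ for all $n$), and $N(C;x)=\emptyset$ for $x\notin C$. Let $F:[0,T]\times H\rightrightarrows H$ have nonempty, closed, convex values and satisfy: (H1) for every $t\in[0,T]$, $F(t,\cdot)$ is upper semicontinuous from $H$ into $H$ with the weak topology, i.e. $\{x:F(t,x)\cap A\ne\emptyset\}$ is closed for every weakly closed $A\subset H$; (H2) $h:H\to[0,\infty)$ is Lipschitz continuous and, for every $x\in H$, $d(0,F(t,x))\le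 h(x)$ for a.e. $t\in[0,T]$; (H3) $\gamma>0$ and $f:[0,T]\times H\to H$ satisfy $f(t,x)\in\operatorname{proj}^{\gamma}_{F(t,x)}(0)$ for all $(t,x)$, and $f(\cdot,x)$ is (strongly) measurable for every $x\in H$. Let $x_0\in C$, $\mu_n=T/n$ and $t_k^n=k\mu_n$ for $n\ge1$, $0\le k\le n$, and let $\varepsilon_n>0$ satisfy $\varepsilon_n/\mu_n^2\to0$. For each $n\ge1$ let $x_0^n=x_0$ and, for $0\le k<n$, let $$x_{k+1}^n\in\operatorname{proj}_C^{\varepsilon_n}\Big(x_k^n+\int_{t_k^n}^{t_{k+1}^n}f(s,x_k^n)\,ds\Big)$$ be chosen arbitrarily; let $x_n(0)=x_0$ and, for $t\in\,]t_k^n,t_{k+1}^n]$, $$x_n(t)=x_k^n+\frac{t-t_k^n}{\mu_n}\Big(x_{k+1}^n-x_k^n-\int_{t_k^n}^{t_{k+1}^n}f(s,x_k^n)\,ds\Big)+\int_{t_k^n}^{t}f(s,x_k^n)\,ds .$$ Then a subsequence of $(x_n)$ converges uniformly on $[0,T]$ to a Lipschitz function $x:[0,T]\to H$ with $$\dot x(t)\in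 -N(C;x(t))+F(t,x(t))\ \text{ for a.e. } t\in[0,T],\qquad x(0)=x_0,$$ and $\|\dot x(t)\|\le 2\big(h(x(t))+\sqrt\gamma\big)$ for a.e. $t\in[0,T]$. -/

import Mathlib

open Set Filter Topology MeasureTheory
open scoped NNReal Pointwise RealInnerProductSpace

namespace Sweeping

section Defs

variable {H : Type*} [NormedAddCommGroup H] [InnerProductSpace ℝ H]

/-- `S` is ball compact: `S ∩ r𝔹` is compact for every `r > 0`. -/
def BallCompact (S : Set H) : Prop :=
  ∀ r : ℝ, 0 < r → IsCompact (S ∩ Metric.closedBall 0 r)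

/-- The Clarke tangent cone `T(S; x)`, described through sequences. -/
def clarkeTangentCone (S : Set H) (x : H) : Set H :=
  {v | ∀ (y : ℕ → H) (τ : ℕ → ℝ), (∀ n, y n ∈ S) → Tendsto y atTop (𝓝 x) →
    (∀ n, 0 < τ n) → Tendsto τ atTop (𝓝 0) →
    ∃ w : ℕ → H, Tendsto w atTop (𝓝 v) ∧ ∀ n, y n + τ n • w n ∈ S}

/-- The Clarke normal cone `N(S; x)`: the negative polar of the Clarke tangent cone if `x ∈ S`,
and the empty set if `x ∉ S`. -/
def clarkeNormalCone (S : Set H) (x : H) : Set H :=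
  {v | x ∈ S ∧ ∀ w ∈ clarkeTangentCone S x, ⟪v, w⟫ ≤ 0}

/-- The set `proj_S^ε(x)` of `ε`-approximate projections of `x` onto `S`. -/
def approxProj (ε : ℝ) (S : Set H) (x : H) : Set H :=
  {z | z ∈ S ∧ ‖x - z‖ ^ 2 < Metric.infDist x S ^ 2 + ε}

/-- Upper semicontinuity of a set-valued map from `H` (norm topology) into `H` with its weak
topology: the inverse image of every weakly closed set is closed. -/
def UpperSemicontinuousWeak (G : H → Set H) : Prop :=
  ∀ A : Set H, IsClosed (toWeakSpace ℝ H '' A) → IsClosed {x | (G x ∩ A).Nonempty}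

/-- The node `t_k^n = k T / n` of the uniform partition of `[0, T]` with step `T / n`. -/
noncomputable def gridPoint (T : ℝ) (n k : ℕ) : ℝ := k * (T / n)

/-- `x : [0, T] → H` is an `n`-th iterate of the catching-up algorithm with approximate
projections for the fixed set `C`, the selection `f`, the initial point `x₀` and the tolerance `ε`;
`node k` is the discrete state `x_k^n`. -/
structure IsCatchingUpIterate (T : ℝ) (C : Set H) (f : ℝ → H → H) (x₀ : H) (n : ℕ) (ε : ℝ)
    (node : ℕ → H) (x : ℝ → H) : Prop where
  node_zero : node 0 = x₀
  node_succ : ∀ k < n, node (k + 1) ∈ approxProj ε C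
    (node k + ∫ s in (gridPoint T n k)..(gridPoint T n (k + 1)), f s (node k))
  initial : x 0 = x₀
  interp : ∀ k < n, ∀ t ∈ Ioc (gridPoint T n k) (gridPoint T n (k + 1)),
    x t = node k
      + ((t - gridPoint T n k) / (T / n)) • (node (k + 1) - node k
          - ∫ s in (gridPoint T n k)..(gridPoint T n (k + 1)), f s (node k))
      + ∫ s in (gridPoint T n k)..t, f s (node k)

/-- `x` is a Lipschitz solution on `[0, T]` of the sweeping process
`ẋ(t) ∈ -N(C; x(t)) + F(t, x(t))` for a.e. `t`, with `x(0) = x₀`. -/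
structure IsLipschitzSolution (T : ℝ) (C : Set H) (F : ℝ → H → Set H) (x₀ : H) (x : ℝ → H) :
    Prop where
  lipschitz : ∃ K : ℝ≥0, LipschitzOnWith K x (Icc 0 T)
  initial : x 0 = x₀
  inclusion : ∀ᵐ t ∂(volume.restrict (Icc 0 T)), DifferentiableAt ℝ x t ∧
    deriv x t ∈ -clarkeNormalCone C (x t) + F t (x t)

end Defs

end Sweeping

/-! The derivative of an iterate is the drift f(s, x_k^n) plus a `correction` that is constant on
each cell of the grid. The node x_k^n lies in C, so it competes in the approximate projection; hence
drift and correction are each at most h(x_k^n) + √γ, the latter up to the vanishing error √ε_n/μ_n.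
A discrete Gronwall inequality bounds the nodes, hence the velocities. The iterates are thus
equi-Lipschitz and O(μ_n)-close to a compact piece of C, and Arzelà–Ascoli yields a uniform limit x.

The velocities need not converge strongly. Almost minimal vectors in the convex hulls of the tails
(`exists_tendsto_linearCombination`) give forward convex combinations, with weights independent of
time, that converge in L² and then a.e. along a subsequence. Drift and correction are handled as a
pair so that they share the weights. Dominated convergence identifies the sum of the two limits with
the derivative of x.

A closed convex constraint satisfied by all late terms survives in the limit
(`mem_of_tendsto_linearCombination`). Applied to half-spaces, it puts the limit drift in F(t, x(t)),
by Hahn–Banach separation and weak upper semicontinuity, and the negated limit correction in N(C;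
x(t)), by the approximate proximal inequality. Applied to balls, it gives the speed bound. -/

namespace Sweeping

/-! ### Forward convex combinations in place of weak compactness -/

section ConvexCombinations

/-- Finitely supported convex weights on `ℕ` that vanish below `n`. -/
def tailWeights (n : ℕ) : Set (ℕ →₀ ℝ) :=
  {w | (∀ i, 0 ≤ w i) ∧ (∀ i < n, w i = 0) ∧ Finsupp.linearCombination ℝ (fun _ => (1 : ℝ)) w = 1}

lemma convex_tailWeights (n : ℕ) : Convex ℝ (tailWeights n) := by
  rintro w ⟨hw, hw', hw1⟩ z ⟨hz, hz', hz1⟩ a b ha hb hab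
  refine ⟨fun i => ?_, fun i hi => ?_, ?_⟩
  · have := mul_nonneg ha (hw i)
    have := mul_nonneg hb (hz i)
    simp only [Finsupp.add_apply, Finsupp.smul_apply, smul_eq_mul]
    positivity
  · simp [hw' i hi, hz' i hi]
  · rw [map_add, map_smul, map_smul, hw1, hz1]
    simpa using hab

lemma tailWeights_antitone : Antitone tailWeights := fun _ _ hmn _ hw =>
  ⟨hw.1, fun i hi => hw.2.1 i (hi.trans_le hmn), hw.2.2⟩

lemma single_mem_tailWeights (n : ℕ) : Finsupp.single n 1 ∈ tailWeights n := by
  refine ⟨fun i => ?_, fun i hi => ?_, by simp⟩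
  · rw [Finsupp.single_apply]; split_ifs <;> norm_num
  · rw [Finsupp.single_apply, if_neg hi.ne']

lemma linearCombination_mem_of_tailWeights {E : Type*} [AddCommGroup E] [Module ℝ E] {S : Set E}
    (hS : Convex ℝ S) {b : ℕ → E} {n : ℕ} (hb : ∀ i, n ≤ i → b i ∈ S) {w : ℕ →₀ ℝ}
    (hw : w ∈ tailWeights n) : Finsupp.linearCombination ℝ b w ∈ S := by
  obtain ⟨h0, h1, h2⟩ := hw
  rw [Finsupp.linearCombination_apply, Finsupp.sum] at *
  refine hS.sum_mem (fun i _ => h0 i) (by simpa using h2) fun i hi => hb i ?_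
  by_contra hlt
  exact (Finsupp.mem_support_iff.1 hi) (h1 i (not_le.1 hlt))

variable {E : Type*} [NormedAddCommGroup E]

/-- Since `W n` vanishes below `n`, the combinations with large `n` involve only terms already in
`S`. -/
lemma mem_of_tendsto_linearCombination [NormedSpace ℝ E] {S : Set E} (hS : Convex ℝ S)
    (hSc : IsClosed S) {b : ℕ → E} (hb : ∀ᶠ i in atTop, b i ∈ S) {W : ℕ → ℕ →₀ ℝ}
    (hW : ∀ n, W n ∈ tailWeights n) {g : E}
    (hg : Tendsto (fun n => Finsupp.linearCombination ℝ b (W n)) atTop (𝓝 g)) : g ∈ S := by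
  obtain ⟨N, hN⟩ := eventually_atTop.1 hb
  refine hSc.mem_of_tendsto hg ?_
  filter_upwards [eventually_ge_atTop N] with n hn
  exact linearCombination_mem_of_tailWeights hS (fun i hi => hN i (hn.trans hi)) (hW n)

lemma tendsto_linearCombination [NormedSpace ℝ E] {b : ℕ → E} {l : E}
    (hb : Tendsto b atTop (𝓝 l)) {W : ℕ → ℕ →₀ ℝ} (hW : ∀ n, W n ∈ tailWeights n) :
    Tendsto (fun n => Finsupp.linearCombination ℝ b (W n)) atTop (𝓝 l) := by
  refine Metric.tendsto_atTop.2 fun ε hε => ?_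
  obtain ⟨N, hN⟩ := Metric.tendsto_atTop.1 hb ε hε
  exact ⟨N, fun n hn => linearCombination_mem_of_tailWeights (convex_ball l ε)
    (fun i hi => hN i (hn.trans hi)) (hW n)⟩

/-- A bounded sequence of a Hilbert space has strongly convergent forward convex combinations. -/
theorem exists_tendsto_linearCombination [InnerProductSpace ℝ E] [CompleteSpace E] {a : ℕ → E}
    {M : ℝ} (ha : ∀ n, ‖a n‖ ≤ M) :
    ∃ W : ℕ → ℕ →₀ ℝ, (∀ n, W n ∈ tailWeights n) ∧
      ∃ g, Tendsto (fun n => Finsupp.linearCombination ℝ a (W n)) atTop (𝓝 g) := by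
  set A : ℕ → Set E := fun n => Finsupp.linearCombination ℝ a '' tailWeights n with hA
  have hne : ∀ n, (A n).Nonempty := fun n => ⟨_, mem_image_of_mem _ (single_mem_tailWeights n)⟩
  have hconv : ∀ n, Convex ℝ (A n) := fun n => (convex_tailWeights n).linear_image _
  have hanti : Antitone A := fun m n hmn => image_mono (tailWeights_antitone hmn)
  set d : ℕ → ℝ := fun n => Metric.infDist 0 (A n) with hd
  have hmono : Monotone d := fun m n hmn =>
    Metric.infDist_le_infDist_of_subset (hanti hmn) (hne n)
  have hle : ∀ n, ∀ g ∈ A n, d n ≤ ‖g‖ := fun n g hg => by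
    simpa using Metric.infDist_le_dist_of_mem (x := (0 : E)) hg
  have hbdd : BddAbove (range d) := by
    refine ⟨M, ?_⟩
    rintro _ ⟨n, rfl⟩
    refine (hle n _ (mem_image_of_mem _ (single_mem_tailWeights n))).trans ?_
    simpa using ha n
  set D : ℝ := ⨆ n, d n with hD
  have hdD : Tendsto d atTop (𝓝 D) := tendsto_atTop_ciSup hmono hbdd
  have hdle : ∀ n, d n ≤ D := fun n => le_ciSup hbdd n
  have hd0 : ∀ n, 0 ≤ d n := fun n => Metric.infDist_nonneg
  have key : ∀ n : ℕ, ∃ w ∈ tailWeights n,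
      ‖Finsupp.linearCombination ℝ a w‖ < d n + 1 / ((n : ℝ) + 1) := fun n => by
    have hpos : (0 : ℝ) < 1 / ((n : ℝ) + 1) := by positivity
    obtain ⟨_, ⟨w, hw, rfl⟩, hlt⟩ := (Metric.infDist_lt_iff (hne n)).1
      (lt_add_of_pos_right (d n) hpos)
    exact ⟨w, hw, by simpa using hlt⟩
  choose W hW hWlt using key
  refine ⟨W, hW, ?_⟩
  refine cauchySeq_tendsto_of_complete (cauchySeq_of_le_tendsto_0
    (fun N : ℕ => √(4 * (D + 1 / ((N : ℝ) + 1)) ^ 2 - 4 * d N ^ 2)) ?_ ?_)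
  · intro n m N hn hm
    rw [dist_eq_norm]
    apply Real.le_sqrt_of_sq_le
    set g := fun n => Finsupp.linearCombination ℝ a (W n) with hg
    have hmem : ∀ k, N ≤ k → g k ∈ A N := fun k hk => hanti hk (mem_image_of_mem _ (hW k))
    have hup : ∀ k, N ≤ k → ‖g k‖ ≤ D + 1 / ((N : ℝ) + 1) := fun k hk => by
      refine (hWlt k).le.trans (add_le_add (hdle k) ?_)
      have : (N : ℝ) ≤ k := by exact_mod_cast hk
      gcongr
    -- The midpoint stays in the convex set `A N`, so it cannot be shorter than `d N`; the
    -- parallelogram law turns this into closeness of two almost minimal vectors.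
    have hmid : d N ≤ ‖(1 / 2 : ℝ) • g n + (1 / 2 : ℝ) • g m‖ :=
      hle N _ (hconv N (hmem n hn) (hmem m hm) (by norm_num) (by norm_num) (by norm_num))
    have hsum : 2 * d N ≤ ‖g n + g m‖ := by
      rw [← smul_add, norm_smul] at hmid
      norm_num at hmid
      linarith
    have hpar := parallelogram_law_with_norm ℝ (g n) (g m)
    have h1 := pow_le_pow_left₀ (norm_nonneg _) (hup n hn) 2
    have h2 := pow_le_pow_left₀ (norm_nonneg _) (hup m hm) 2
    have h3 := pow_le_pow_left₀ (by have := hd0 N; positivity) hsum 2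
    change ‖g n - g m‖ ^ 2 ≤ _
    nlinarith
  · have h1 : Tendsto (fun N : ℕ => 1 / ((N : ℝ) + 1)) atTop (𝓝 0) :=
      tendsto_one_div_add_atTop_nhds_zero_nat
    have h2 := ((((h1.const_add D).pow 2).const_mul 4).sub ((hdD.pow 2).const_mul 4)).sqrt
    simpa using h2

/-- A uniformly bounded sequence of Hilbert-valued functions on a finite measure space has forward
convex combinations that converge almost everywhere. -/
theorem exists_ae_tendsto_linearCombination [InnerProductSpace ℝ E] [CompleteSpace E]
    {α : Type*} {mα : MeasurableSpace α} {μ : Measure α} [IsFiniteMeasure μ] {p : ℕ → α → E}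
    (hp : ∀ n, AEStronglyMeasurable (p n) μ) {M : ℝ} (hM : ∀ n, ∀ᵐ s ∂μ, ‖p n s‖ ≤ M) :
    ∃ W : ℕ → ℕ →₀ ℝ, (∀ n, W n ∈ tailWeights n) ∧
      ∃ g : α → E, ∀ᵐ s ∂μ,
        Tendsto (fun n => Finsupp.linearCombination ℝ (fun i => p i s) (W n)) atTop (𝓝 (g s)) := by
  have hL : ∀ n, MemLp (p n) 2 μ := fun n => MemLp.of_bound (hp n) M (hM n)
  have hM' : ∀ n, ∀ᵐ s ∂μ, ‖p n s‖ ≤ max M 0 := fun n =>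
    (hM n).mono fun s hs => hs.trans (le_max_left _ _)
  obtain ⟨W, hW, g, hg⟩ := exists_tendsto_linearCombination
    (a := fun n => (hL n).toLp (p n)) (fun n => Lp.norm_le_of_ae_bound (le_max_right M 0)
      (((hL n).coeFn_toLp).mp ((hM' n).mono fun s hs h => by rwa [h])))
  have hcomb : ∀ w : ℕ →₀ ℝ, (Finsupp.linearCombination ℝ (fun n => (hL n).toLp (p n)) w : α → E)
      =ᵐ[μ] fun s => Finsupp.linearCombination ℝ (fun i => p i s) w := by
    intro w
    induction w using Finsupp.induction_linear with
    | zero =>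
      simp only [map_zero]
      exact Lp.coeFn_zero E 2 μ
    | add w z hw hz =>
      rw [map_add]
      filter_upwards [Lp.coeFn_add (Finsupp.linearCombination ℝ (fun n => (hL n).toLp (p n)) w)
        (Finsupp.linearCombination ℝ (fun n => (hL n).toLp (p n)) z), hw, hz] with s h1 h2 h3
      rw [h1, Pi.add_apply, h2, h3, map_add]
    | single i c =>
      simp only [Finsupp.linearCombination_single]
      filter_upwards [Lp.coeFn_smul c ((hL i).toLp (p i)), (hL i).coeFn_toLp] with s h1 h2
      rw [h1, Pi.smul_apply, h2]
  obtain ⟨ns, hns, hae⟩ := (tendstoInMeasure_of_tendsto_Lp hg).exists_seq_tendsto_ae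
  -- Since `ns n ≥ n`, the weights along the subsequence are still supported beyond `n`.
  refine ⟨fun n => W (ns n), fun n => tailWeights_antitone (hns.id_le n) (hW (ns n)), g, ?_⟩
  filter_upwards [hae, ae_all_iff.2 fun n => hcomb (W (ns n))] with s h1 h2
  simpa only [h2] using h1

end ConvexCombinations


/-! ### Arzelà–Ascoli for curves approaching a compact set -/

section Compactness

/-- Late sets lie within ε/2 of `K` and share one finite net of `K`; the finitely many early ones
use their own nets. -/
lemma totallyBounded_iUnion_of_dist_le {E : Type*} [PseudoMetricSpace E] {S : ℕ → Set E}
    (hS : ∀ n, TotallyBounded (S n)) {K : Set E} (hK : TotallyBounded K) {δ : ℕ → ℝ}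
    (hδ : Tendsto δ atTop (𝓝 0)) (hSK : ∀ n, ∀ x ∈ S n, ∃ z ∈ K, dist x z ≤ δ n) :
    TotallyBounded (⋃ n, S n) := by
  refine Metric.totallyBounded_iff.2 fun ε hε => ?_
  obtain ⟨N, hN⟩ := eventually_atTop.1 (hδ.eventually_lt_const (half_pos hε))
  obtain ⟨t, ht, hKt⟩ := Metric.totallyBounded_iff.1 hK (ε / 2) (half_pos hε)
  choose t' ht' hSt' using fun n => Metric.totallyBounded_iff.1 (hS n) ε hε
  refine ⟨t ∪ ⋃ n ∈ Iio N, t' n, ht.union ((finite_Iio N).biUnion fun n _ => ht' n), ?_⟩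
  refine iUnion_subset fun n x hx => ?_
  rcases lt_or_ge n N with hn | hn
  · obtain ⟨y, hy, hxy⟩ := mem_iUnion₂.1 (hSt' n hx)
    exact mem_iUnion₂.2 ⟨y, Or.inr (mem_iUnion₂.2 ⟨n, hn, hy⟩), hxy⟩
  · obtain ⟨z, hz, hxz⟩ := hSK n x hx
    obtain ⟨y, hy, hzy⟩ := mem_iUnion₂.1 (hKt hz)
    refine mem_iUnion₂.2 ⟨y, Or.inl hy, Metric.mem_ball.2 ?_⟩
    have := hN n hn
    have := Metric.mem_ball.1 hzy
    linarith [dist_triangle x z y]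

/-- A sequence of equi-Lipschitz curves whose distance to a compact set tends to zero has a
uniformly convergent subsequence. -/
theorem exists_subseq_tendstoUniformlyOn {E : Type*} [MetricSpace E] [CompleteSpace E] {a b : ℝ}
    {x : ℕ → ℝ → E} {L : ℝ≥0} (hL : ∀ n, LipschitzOnWith L (x n) (Icc a b)) {K : Set E}
    (hK : IsCompact K) {δ : ℕ → ℝ} (hδ : Tendsto δ atTop (𝓝 0))
    (hx : ∀ n, ∀ t ∈ Icc a b, ∃ z ∈ K, dist (x n t) z ≤ δ n) :
    ∃ (φ : ℕ → ℕ) (y : ℝ → E), StrictMono φ ∧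
      TendstoUniformlyOn (fun j => x (φ j)) y atTop (Icc a b) := by
  have hlip : ∀ n, LipschitzWith L ((Icc a b).domRestrict (x n)) := fun n =>
    (hL n).to_restrict
  let F : ℕ → BoundedContinuousFunction (Icc a b) E := fun n =>
    BoundedContinuousFunction.mkOfCompact ⟨(Icc a b).domRestrict (x n), (hlip n).continuous⟩
  have hS : IsCompact (closure (⋃ n, x n '' Icc a b)) := by
    refine (totallyBounded_iUnion_of_dist_le (fun n => ?_) hK.totallyBounded hδ
      ?_).closure.isCompact_of_isClosed isClosed_closure
    · exact (isCompact_Icc.image_of_continuousOn (hL n).continuousOn).totallyBounded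
    · rintro n _ ⟨t, ht, rfl⟩
      exact hx n t ht
  have hA : IsCompact (closure (range F)) := by
    refine BoundedContinuousFunction.arzela_ascoli _ hS _ ?_ ?_
    · rintro _ t ⟨n, rfl⟩
      exact subset_closure (mem_iUnion.2 ⟨n, mem_image_of_mem _ t.2⟩)
    · refine (LipschitzWith.uniformEquicontinuous _ L ?_).equicontinuous
      rintro ⟨_, n, rfl⟩
      exact hlip n
  obtain ⟨g, -, φ, hφ, hlim⟩ := hA.tendsto_subseq fun n => subset_closure (mem_range_self n)
  classical
  refine ⟨φ, fun t => if h : t ∈ Icc a b then g ⟨t, h⟩ else x 0 t, hφ, ?_⟩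
  rw [tendstoUniformlyOn_iff_tendstoUniformly_comp_coe]
  convert BoundedContinuousFunction.tendsto_iff_tendstoUniformly.1 hlim using 1
  · rfl
  · funext t
    exact dif_pos t.2

end Compactness


/-! ### The time grid and one-step estimates -/

section Discrete

/-- The index `k` with `s ∈ ]t_k^n, t_{k+1}^n]`. -/
noncomputable def gridIndex (T : ℝ) (n : ℕ) (s : ℝ) : ℕ := ⌈s / (T / n)⌉₊ - 1

lemma measurable_gridIndex (T : ℝ) (n : ℕ) : Measurable (gridIndex T n) :=
  (measurable_from_top (f := fun m : ℕ => m - 1)).comp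
    (Nat.measurable_ceil.comp (measurable_id.div_const _))

lemma gridPoint_zero (T : ℝ) (n : ℕ) : gridPoint T n 0 = 0 := by simp [gridPoint]

lemma gridPoint_succ (T : ℝ) (n k : ℕ) : gridPoint T n (k + 1) = gridPoint T n k + T / n := by
  simp only [gridPoint, Nat.cast_add, Nat.cast_one]; ring

lemma gridPoint_self (T : ℝ) {n : ℕ} (hn : 1 ≤ n) : gridPoint T n n = T := by
  have : (n : ℝ) ≠ 0 := by positivity
  simp only [gridPoint]; field_simp

lemma gridPoint_mono {T : ℝ} (hT : 0 < T) (n : ℕ) : Monotone (gridPoint T n) := fun i j hij => by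
  have : (i : ℝ) ≤ j := by exact_mod_cast hij
  unfold gridPoint; gcongr

lemma gridPoint_mem {T : ℝ} (hT : 0 < T) {n k : ℕ} (hn : 1 ≤ n) (hk : k ≤ n) :
    gridPoint T n k ∈ Icc 0 T :=
  ⟨by simpa [gridPoint_zero] using gridPoint_mono hT n (Nat.zero_le k),
    by simpa [gridPoint_self T hn] using gridPoint_mono hT n hk⟩

lemma gridIndex_eq {T : ℝ} (hT : 0 < T) {n k : ℕ} (hn : 1 ≤ n) {s : ℝ}
    (hs : s ∈ Ioc (gridPoint T n k) (gridPoint T n (k + 1))) : gridIndex T n s = k := by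
  have hμ : 0 < T / n := by positivity
  have : ⌈s / (T / n)⌉₊ = k + 1 := by
    rw [Nat.ceil_eq_iff (by simp)]
    constructor
    · simpa [lt_div_iff₀ hμ, gridPoint] using hs.1
    · simpa [div_le_iff₀ hμ, gridPoint] using hs.2
  simp [gridIndex, this]

lemma gridIndex_spec {T : ℝ} (hT : 0 < T) {n : ℕ} (hn : 1 ≤ n) {s : ℝ} (hs : s ∈ Ioc 0 T) :
    gridIndex T n s < n ∧
      s ∈ Ioc (gridPoint T n (gridIndex T n s)) (gridPoint T n (gridIndex T n s + 1)) := by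
  have hμ : 0 < T / n := by positivity
  have hn' : (0 : ℝ) < n := by positivity
  -- As s > 0, the ceiling is at least 1 and the truncated subtraction in `gridIndex` loses nothing.
  have hpos : 0 < ⌈s / (T / n)⌉₊ := Nat.ceil_pos.2 (div_pos hs.1 hμ)
  obtain ⟨k, hk⟩ : ∃ k, ⌈s / (T / n)⌉₊ = k + 1 := ⟨_, (Nat.succ_pred_eq_of_pos hpos).symm⟩
  have hidx : gridIndex T n s = k := by simp [gridIndex, hk]
  rw [hidx]
  have h2 := (Nat.ceil_eq_iff (by simp)).1 hk
  simp only [Nat.add_sub_cancel, lt_div_iff₀ hμ, div_le_iff₀ hμ] at h2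
  refine ⟨?_, h2⟩
  have h3 : k * (T / n) < n * (T / n) := by
    refine h2.1.trans_le (hs.2.trans_eq ?_)
    field_simp
  exact_mod_cast lt_of_mul_lt_mul_right h3 hμ.le

/-- Each step multiplies `a k + A` by at most 1 + (B+1)T/n. The rate B+1 instead of B avoids
dividing by B, which may be zero. -/
lemma discrete_gronwall {T A B : ℝ} (hT : 0 < T) (hA : 0 ≤ A) (hB : 0 ≤ B) {n : ℕ} (hn : 1 ≤ n)
    {a : ℕ → ℝ} (ha0 : a 0 = 0) (ha : ∀ k, 0 ≤ a k)
    (hstep : ∀ k < n, a (k + 1) ≤ a k + T / n * (A + B * a k)) {k : ℕ} (hk : k ≤ n) :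
    a k ≤ A * Real.exp ((B + 1) * T) := by
  have hμ : 0 < T / n := by positivity
  have hn' : (0 : ℝ) < n := by positivity
  have key : ∀ k ≤ n, a k + A ≤ A * Real.exp ((B + 1) * (k * (T / n))) := by
    intro k
    induction k with
    | zero => intro _; simp [ha0]
    | succ k ih =>
      intro hk
      have h1 := ih (by omega)
      have h2 := hstep k (by omega)
      have h3 : a (k + 1) + A ≤ (1 + (B + 1) * (T / n)) * (a k + A) := by
        have : 0 ≤ T / n * (a k + B * A) := by have := ha k; positivity
        nlinarith
      have h4 : 1 + (B + 1) * (T / n) ≤ Real.exp ((B + 1) * (T / n)) := by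
        linarith [Real.add_one_le_exp ((B + 1) * (T / n))]
      calc a (k + 1) + A ≤ (1 + (B + 1) * (T / n)) * (a k + A) := h3
        _ ≤ Real.exp ((B + 1) * (T / n)) * (A * Real.exp ((B + 1) * (k * (T / n)))) := by
          gcongr
          exact add_nonneg (ha k) hA
        _ = A * Real.exp ((B + 1) * ((k + 1 : ℕ) * (T / n))) := by
          rw [mul_left_comm, ← Real.exp_add]; push_cast; ring_nf
  have h5 : (k : ℝ) * (T / n) ≤ T := (gridPoint_mem hT hn hk).2
  calc a k ≤ a k + A := by linarith
    _ ≤ _ := key k hk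
    _ ≤ _ := by gcongr

/-- Used both for the selection `f` (projecting 0 onto `F t y`) and for the nodes (projecting onto
`C`). -/
lemma norm_sub_le_of_mem_approxProj {H : Type*} [NormedAddCommGroup H] {ε r : ℝ}
    (hε : 0 ≤ ε) {S : Set H} {p z : H}
    (hz : z ∈ approxProj ε S p)
    (hr : Metric.infDist p S ≤ r) : ‖p - z‖ ≤ r + √ε := by
  have hr0 : 0 ≤ r := Metric.infDist_nonneg.trans hr
  refine le_of_sq_le_sq ?_ (by positivity)
  have h1 := hz.2
  have h2 : Metric.infDist p S ^ 2 ≤ r ^ 2 := pow_le_pow_left₀ Metric.infDist_nonneg hr 2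
  have h3 := Real.sq_sqrt hε
  have h4 : 0 ≤ r * √ε := by positivity
  nlinarith

variable {H : Type*} [NormedAddCommGroup H] [InnerProductSpace ℝ H]

/-- Approximate proximal normal inequality: take `y` as competitor and expand the square of p - y =
(p - z) - (y - z). -/
lemma inner_le_of_mem_approxProj {ε : ℝ} {S : Set H} {p z y : H}
    (hz : z ∈ approxProj ε S p) (hy : y ∈ S) : 2 * ⟪p - z, y - z⟫ ≤ ‖y - z‖ ^ 2 + ε := by
  have h1 := hz.2
  have h2 : Metric.infDist p S ^ 2 ≤ ‖p - y‖ ^ 2 :=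
    pow_le_pow_left₀ Metric.infDist_nonneg
      (by simpa [dist_eq_norm] using Metric.infDist_le_dist_of_mem (x := p) hy) 2
  have h3 : ‖p - y‖ ^ 2 = ‖p - z‖ ^ 2 - 2 * ⟪p - z, y - z⟫ + ‖y - z‖ ^ 2 := by
    rw [← norm_sub_sq_real, sub_sub_sub_cancel_right]
  linarith

/-- The slope on `]t_k^n, t_{k+1}^n]` of the affine part of a catching-up iterate. -/
noncomputable def correction (T : ℝ) (f : ℝ → H → H) (n : ℕ) (node : ℕ → H) (k : ℕ) : H :=
  (T / n)⁻¹ • (node (k + 1) - node k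
    - ∫ s in (gridPoint T n k)..(gridPoint T n (k + 1)), f s (node k))

variable {T : ℝ} {C : Set H} {f : ℝ → H → H} {x₀ : H} {n : ℕ} {ε : ℝ} {node : ℕ → H} {x : ℝ → H}

namespace IsCatchingUpIterate

lemma node_mem (hx : IsCatchingUpIterate T C f x₀ n ε node x) (hx₀ : x₀ ∈ C) :
    ∀ k ≤ n, node k ∈ C
  | 0, _ => hx.node_zero ▸ hx₀
  | k + 1, hk => (hx.node_succ k hk).1

lemma norm_integral_le (hT : 0 < T) (hn : 1 ≤ n) {y : H} {c : ℝ}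
    (hc : ∀ᵐ t ∂(volume.restrict (Icc 0 T)), ‖f t y‖ ≤ c) {k : ℕ} (hk : k < n) :
    ‖∫ s in (gridPoint T n k)..(gridPoint T n (k + 1)), f s y‖ ≤ T / n * c := by
  have hμ : 0 < T / n := by positivity
  have h0 := gridPoint_mem hT hn hk.le
  have h1 := gridPoint_mem hT hn (k := k + 1) hk
  have hle : gridPoint T n k ≤ gridPoint T n (k + 1) := gridPoint_mono hT n (Nat.le_succ k)
  refine (intervalIntegral.norm_integral_le_of_norm_le_const_ae (C := c) ?_).trans_eq ?_
  · filter_upwards [(ae_restrict_iff' measurableSet_Icc).1 hc] with s hs hs'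
    rw [uIoc_of_le hle] at hs'
    exact hs ⟨h0.1.trans hs'.1.le, hs'.2.trans h1.2⟩
  · rw [gridPoint_succ, add_sub_cancel_left, abs_of_pos hμ, mul_comm]

/-- The current node lies in `C` and differs from the point being projected by the integral of the
drift, so the distance to `C` is at most `T / n * c`. -/
lemma norm_correction_le (hx : IsCatchingUpIterate T C f x₀ n ε node x) (hT : 0 < T) (hn : 1 ≤ n)
    (hε : 0 ≤ ε) (hx₀ : x₀ ∈ C) {c : ℝ} {k : ℕ} (hk : k < n)
    (hc : ∀ᵐ t ∂(volume.restrict (Icc 0 T)), ‖f t (node k)‖ ≤ c) :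
    ‖correction T f n node k‖ ≤ c + √(ε / (T / n) ^ 2) := by
  have hμ : 0 < T / n := by positivity
  have hI := norm_integral_le hT hn hc hk
  have hd : Metric.infDist (node k + ∫ s in (gridPoint T n k)..(gridPoint T n (k + 1)),
      f s (node k)) C ≤ T / n * c := by
    refine (Metric.infDist_le_dist_of_mem (hx.node_mem hx₀ k hk.le)).trans ?_
    simpa [dist_eq_norm] using hI
  have h1 := norm_sub_le_of_mem_approxProj hε (hx.node_succ k hk) hd
  rw [correction, norm_smul, norm_inv, Real.norm_of_nonneg hμ.le, inv_mul_le_iff₀ hμ,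
    Real.sqrt_div' _ (sq_nonneg _), Real.sqrt_sq hμ.le, mul_add, mul_div_cancel₀ _ hμ.ne',
    sub_sub, norm_sub_rev]
  exact h1

lemma node_succ_sub (hT : 0 < T) (hn : 1 ≤ n) (k : ℕ) :
    node (k + 1) - node k = (T / n) • correction T f n node k
      + ∫ s in (gridPoint T n k)..(gridPoint T n (k + 1)), f s (node k) := by
  have hμ : T / n ≠ 0 := by positivity
  rw [correction, smul_inv_smul₀ hμ, sub_add_cancel]

/-- The proximal inequality at the competitor `node (k + 1) + τ • w`, divided by 2τT/n. The free
parameter τ is later set to √ε, which balances the two error terms. -/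
lemma inner_correction_le (hx : IsCatchingUpIterate T C f x₀ n ε node x) (hT : 0 < T)
    (hn : 1 ≤ n) {k : ℕ} (hk : k < n) {τ : ℝ} (hτ : 0 < τ) {w : H}
    (hw : node (k + 1) + τ • w ∈ C) :
    ⟪-correction T f n node k, w⟫ ≤ (τ * ‖w‖ ^ 2 + ε / τ) / (2 * (T / n)) := by
  have hμ : 0 < T / n := by positivity
  have h1 := inner_le_of_mem_approxProj (hx.node_succ k hk) hw
  have h2 : (node k + ∫ s in (gridPoint T n k)..(gridPoint T n (k + 1)), f s (node k))
      - node (k + 1) = -((T / n) • correction T f n node k) := by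
    rw [correction, smul_inv_smul₀ hμ.ne']; abel
  rw [h2, add_sub_cancel_left, inner_neg_left, inner_smul_left, inner_smul_right, norm_smul,
    Real.norm_of_nonneg hτ.le] at h1
  simp only [conj_trivial] at h1
  rw [inner_neg_left, le_div_iff₀ (by positivity), ← mul_le_mul_iff_right₀ hτ]
  have h3 : τ * (ε / τ) = ε := mul_div_cancel₀ _ hτ.ne'
  nlinarith

end IsCatchingUpIterate

end Discrete


/-! ### Iterates as integrals of their velocity, and a priori bounds -/

section IntegralRepresentation

/-- The fibres of `i` form a countable measurable partition. This suffices for the drift, since `f`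
is measurable in time only for a frozen state and a discrete path visits countably many states. -/
lemma aestronglyMeasurable_comp_nat {α E : Type*} [TopologicalSpace E]
    [TopologicalSpace.PseudoMetrizableSpace E] {mα : MeasurableSpace α} {μ : Measure α}
    {F : ℕ → α → E} (hF : ∀ k, AEStronglyMeasurable (F k) μ) {i : α → ℕ} (hi : Measurable i) :
    AEStronglyMeasurable (fun s => F (i s) s) μ := by
  have hU : (⋃ k, i ⁻¹' {k}) = univ := iUnion_eq_univ_iff.2 fun s => ⟨i s, rfl⟩
  rw [← Measure.restrict_univ (μ := μ), ← hU]
  refine AEStronglyMeasurable.iUnion fun k => ((hF k).restrict).congr ?_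
  filter_upwards [ae_restrict_mem (hi (measurableSet_singleton k))] with s hs
  rw [mem_preimage, mem_singleton_iff] at hs
  rw [hs]

lemma lipschitzOnWith_of_eq_integral {E : Type*} [NormedAddCommGroup E] [NormedSpace ℝ E]
    {T : ℝ} {x g : ℝ → E} {x₀ : E} (hx : ∀ t ∈ Icc 0 T, x t = x₀ + ∫ s in (0)..t, g s)
    (hg : IntegrableOn g (Icc 0 T)) {L : ℝ≥0}
    (hL : ∀ᵐ s ∂(volume.restrict (Icc 0 T)), ‖g s‖ ≤ L) : LipschitzOnWith L x (Icc 0 T) := by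
  refine LipschitzOnWith.of_dist_le_mul fun s hs t ht => ?_
  have hint : ∀ r ∈ Icc 0 T, IntervalIntegrable g volume 0 r := fun r hr =>
    (intervalIntegrable_iff_integrableOn_Icc_of_le hr.1).2
      (hg.mono_set (Icc_subset_Icc_right hr.2))
  rw [dist_eq_norm, hx s hs, hx t ht, add_sub_add_left_eq_sub,
    intervalIntegral.integral_interval_sub_left (hint s hs) (hint t ht), Real.dist_eq]
  refine intervalIntegral.norm_integral_le_of_norm_le_const_ae ?_
  filter_upwards [(ae_restrict_iff' measurableSet_Icc).1 hL] with r hr hr'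
  exact hr ((uIcc_subset_Icc ht hs) (uIoc_subset_uIcc hr'))

lemma aestronglyMeasurable_drift {H : Type*} [NormedAddCommGroup H] {T : ℝ}
    {f : ℝ → H → H} {μ : Measure ℝ} (hf : ∀ y, AEStronglyMeasurable (fun t => f t y) μ) (n : ℕ)
    (node : ℕ → H) :
    AEStronglyMeasurable (fun s => f s (node (gridIndex T n s))) μ :=
  aestronglyMeasurable_comp_nat (F := fun k s => f s (node k)) (fun k => hf (node k))
    (measurable_gridIndex T n)

variable {H : Type*} [NormedAddCommGroup H] [InnerProductSpace ℝ H]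
variable {T : ℝ} {C : Set H} {f : ℝ → H → H} {x₀ : H} {n : ℕ} {ε : ℝ} {node : ℕ → H} {x : ℝ → H}

lemma aestronglyMeasurable_correction {μ : Measure ℝ} (n : ℕ) (node : ℕ → H) :
    AEStronglyMeasurable (fun s => correction T f n node (gridIndex T n s)) μ :=
  aestronglyMeasurable_comp_nat (F := fun k _ => correction T f n node k)
    (fun _ => aestronglyMeasurable_const) (measurable_gridIndex T n)

/-- The derivative of a catching-up iterate. -/
noncomputable def velocity (T : ℝ) (f : ℝ → H → H) (n : ℕ) (node : ℕ → H) (s : ℝ) : H :=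
  f s (node (gridIndex T n s)) + correction T f n node (gridIndex T n s)

lemma integral_velocity_of_mem_cell [CompleteSpace H] (hT : 0 < T) (hn : 1 ≤ n)
    (hf : ∀ y, IntegrableOn (fun t => f t y) (Icc 0 T)) {k : ℕ} (hk : k < n) {t : ℝ}
    (ht : t ∈ Icc (gridPoint T n k) (gridPoint T n (k + 1))) :
    ∫ s in (gridPoint T n k)..t, velocity T f n node s =
      (t - gridPoint T n k) • correction T f n node k
        + ∫ s in (gridPoint T n k)..t, f s (node k) := by
  have h0 := gridPoint_mem hT hn hk.le
  have h1 := gridPoint_mem hT hn (k := k + 1) hk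
  have hint : IntervalIntegrable (fun s => f s (node k)) volume (gridPoint T n k) t :=
    (intervalIntegrable_iff_integrableOn_Icc_of_le ht.1).2
      ((hf (node k)).mono_set (Icc_subset_Icc h0.1 (ht.2.trans h1.2)))
  rw [← intervalIntegral.integral_const, add_comm,
    ← intervalIntegral.integral_add hint intervalIntegrable_const]
  refine intervalIntegral.integral_congr_ae (Eventually.of_forall fun s hs => ?_)
  rw [uIoc_of_le ht.1] at hs
  rw [velocity, gridIndex_eq hT hn ⟨hs.1, hs.2.trans ht.2⟩]

namespace IsCatchingUpIterate

variable [CompleteSpace H]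

lemma node_eq_integral (hx : IsCatchingUpIterate T C f x₀ n ε node x) (hT : 0 < T) (hn : 1 ≤ n)
    (hf : ∀ y, IntegrableOn (fun t => f t y) (Icc 0 T))
    (hv : IntegrableOn (velocity T f n node) (Icc 0 T)) :
    ∀ k ≤ n, node k = x₀ + ∫ s in (0)..(gridPoint T n k), velocity T f n node s := by
  intro k
  induction k with
  | zero => intro _; simp [gridPoint_zero, hx.node_zero]
  | succ k ih =>
    intro hk
    have h0 := gridPoint_mem hT hn (k := k) (by omega)
    have h1 := gridPoint_mem hT hn hk
    have hle : gridPoint T n k ≤ gridPoint T n (k + 1) := gridPoint_mono hT n (Nat.le_succ k)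
    have hint : ∀ a ∈ Icc 0 T, ∀ b ∈ Icc 0 T,
        IntervalIntegrable (velocity T f n node) volume a b := fun a ha b hb =>
      (hv.mono_set (uIcc_subset_Icc ha hb)).intervalIntegrable
    rw [← intervalIntegral.integral_add_adjacent_intervals
      (hint 0 ⟨le_rfl, hT.le⟩ _ h0) (hint _ h0 _ h1), ← add_assoc, ← ih (by omega),
      integral_velocity_of_mem_cell hT hn hf hk ⟨hle, le_rfl⟩, gridPoint_succ,
      add_sub_cancel_left, ← gridPoint_succ, ← node_succ_sub hT hn k, add_sub_cancel]

lemma eq_integral (hx : IsCatchingUpIterate T C f x₀ n ε node x) (hT : 0 < T) (hn : 1 ≤ n)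
    (hf : ∀ y, IntegrableOn (fun t => f t y) (Icc 0 T))
    (hv : IntegrableOn (velocity T f n node) (Icc 0 T)) {t : ℝ} (ht : t ∈ Icc 0 T) :
    x t = x₀ + ∫ s in (0)..t, velocity T f n node s := by
  rcases ht.1.eq_or_lt with rfl | h0
  · simp [hx.initial]
  obtain ⟨hk, hmem⟩ := gridIndex_spec hT hn ⟨h0, ht.2⟩
  set k := gridIndex T n t
  have hg := gridPoint_mem hT hn hk.le
  have hint : ∀ a ∈ Icc 0 T, ∀ b ∈ Icc 0 T,
      IntervalIntegrable (velocity T f n node) volume a b := fun a ha b hb =>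
    (hv.mono_set (uIcc_subset_Icc ha hb)).intervalIntegrable
  rw [← intervalIntegral.integral_add_adjacent_intervals
    (hint 0 ⟨le_rfl, hT.le⟩ _ hg) (hint _ hg _ ht), ← add_assoc,
    ← hx.node_eq_integral hT hn hf hv k hk.le,
    integral_velocity_of_mem_cell hT hn hf hk ⟨hmem.1.le, hmem.2⟩, hx.interp k hk t hmem,
    correction, smul_smul, div_eq_mul_inv, add_assoc]

lemma node_eq (hx : IsCatchingUpIterate T C f x₀ n ε node x) (hT : 0 < T) (hn : 1 ≤ n)
    (hf : ∀ y, IntegrableOn (fun t => f t y) (Icc 0 T))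
    (hv : IntegrableOn (velocity T f n node) (Icc 0 T)) {k : ℕ} (hk : k ≤ n) :
    node k = x (gridPoint T n k) := by
  rw [hx.eq_integral hT hn hf hv (gridPoint_mem hT hn hk), hx.node_eq_integral hT hn hf hv k hk]

end IsCatchingUpIterate

/-- The discrete states stay bounded, uniformly in the step size. -/
lemma IsCatchingUpIterate.norm_node_sub_le (hT : 0 < T) (hx₀ : x₀ ∈ C) {c : H → ℝ} (hc0 : 0 ≤ c x₀)
    {L : ℝ≥0} (hcL : LipschitzWith L c)
    (hc : ∀ y, ∀ᵐ t ∂(volume.restrict (Icc 0 T)), ‖f t y‖ ≤ c y) {M : ℝ}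
    (hn : 1 ≤ n) (hε : 0 ≤ ε) (hεM : √(ε / (T / n) ^ 2) ≤ M)
    (hx : IsCatchingUpIterate T C f x₀ n ε node x) {k : ℕ} (hk : k ≤ n) :
    ‖node k - x₀‖ ≤ (2 * c x₀ + M) * Real.exp ((2 * L + 1) * T) := by
  have hμ : 0 < T / n := by positivity
  have hM : 0 ≤ M := (Real.sqrt_nonneg _).trans hεM
  -- The factors 2 arise because drift and correction each contribute `c (node k)`, which is at most
  -- c x₀ + L‖node k - x₀‖.
  refine discrete_gronwall (a := fun k => ‖node k - x₀‖) hT (by positivity) (by positivity) hn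
    (by simp [hx.node_zero]) (fun k => norm_nonneg _) (fun k hk => ?_) hk
  have h1 : c (node k) ≤ c x₀ + L * ‖node k - x₀‖ := by
    have := hcL.dist_le_mul (node k) x₀
    rw [Real.dist_eq, dist_eq_norm] at this
    linarith [le_abs_self (c (node k) - c x₀)]
  have h2 := hx.norm_correction_le hT hn hε hx₀ hk (hc (node k))
  have h3 := norm_integral_le hT hn (hc (node k)) hk
  have h4 : ‖node (k + 1) - node k‖ ≤ T / n * (c (node k) + M) + T / n * c (node k) := by
    rw [node_succ_sub (f := f) hT hn k]
    refine (norm_add_le _ _).trans (add_le_add ?_ h3)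
    rw [norm_smul, Real.norm_of_nonneg hμ.le]
    gcongr
    linarith
  have h5 : ‖node (k + 1) - x₀‖ ≤ ‖node k - x₀‖ + ‖node (k + 1) - node k‖ := by
    linarith [norm_sub_le_norm_sub_add_norm_sub (node (k + 1)) (node k) x₀]
  refine h5.trans (add_le_add le_rfl (h4.trans ?_))
  rw [← mul_add]
  exact mul_le_mul_of_nonneg_left (by linarith) hμ.le

end IntegralRepresentation


/-! ### Passing to the limit in the inclusions -/

section Limit

lemma BallCompact.isClosed {H : Type*} [NormedAddCommGroup H] {C : Set H} (hC : BallCompact C) :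
    IsClosed C := by
  refine isClosed_of_closure_subset fun x hx => ?_
  obtain ⟨y, hy, hyx⟩ := mem_closure_iff_seq_limit.1 hx
  have hr : 0 < ‖x‖ + 1 := by positivity
  refine ((hC _ hr).isClosed.mem_of_tendsto hyx ?_).1
  filter_upwards [hyx.norm.eventually_lt_const (lt_add_one ‖x‖)] with n hn
  exact ⟨hy n, by simpa using hn.le⟩

variable {H : Type*} [NormedAddCommGroup H] [InnerProductSpace ℝ H]

/-- The pair is one function into the Hilbert sum `H × H`, so a single sequence of weights serves
both components. -/
lemma exists_ae_tendsto_linearCombination_prod [CompleteSpace H]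
    {α : Type*} {mα : MeasurableSpace α} {μ : Measure α} [IsFiniteMeasure μ] {p q : ℕ → α → H}
    (hp : ∀ n, AEStronglyMeasurable (p n) μ) (hq : ∀ n, AEStronglyMeasurable (q n) μ) {M : ℝ}
    (hpM : ∀ n, ∀ᵐ s ∂μ, ‖p n s‖ ≤ M) (hqM : ∀ n, ∀ᵐ s ∂μ, ‖q n s‖ ≤ M) :
    ∃ W : ℕ → ℕ →₀ ℝ, (∀ n, W n ∈ tailWeights n) ∧ ∃ g k : α → H,
      (∀ᵐ s ∂μ, Tendsto (fun n => Finsupp.linearCombination ℝ (fun i => p i s) (W n)) atTop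
        (𝓝 (g s))) ∧
      ∀ᵐ s ∂μ, Tendsto (fun n => Finsupp.linearCombination ℝ (fun i => q i s) (W n)) atTop
        (𝓝 (k s)) := by
  obtain ⟨W, hW, G, hG⟩ := exists_ae_tendsto_linearCombination
    (p := fun n s => WithLp.toLp 2 (p n s, q n s)) (M := M + M)
    (fun n => (WithLp.prod_continuous_toLp 2 H H).comp_aestronglyMeasurable ((hp n).prodMk (hq n)))
    (fun n => by
      filter_upwards [hpM n, hqM n] with s h1 h2
      rw [WithLp.prod_norm_eq_of_L2]
      have := norm_nonneg (p n s)
      have := norm_nonneg (q n s)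
      refine Real.sqrt_le_iff.2 ⟨by linarith, ?_⟩
      change ‖p n s‖ ^ 2 + ‖q n s‖ ^ 2 ≤ (M + M) ^ 2
      nlinarith)
  refine ⟨W, hW, fun s => (G s).fst, fun s => (G s).snd, ?_, ?_⟩
  · filter_upwards [hG] with s hs
    have := ((WithLp.fstL 2 ℝ H H).continuous.tendsto _).comp hs
    refine this.congr fun n => ?_
    simp only [Function.comp_apply, Finsupp.linearCombination_apply, Finsupp.sum, map_sum, map_smul]
    rfl
  · filter_upwards [hG] with s hs
    have := ((WithLp.sndL 2 ℝ H H).continuous.tendsto _).comp hs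
    refine this.congr fun n => ?_
    simp only [Function.comp_apply, Finsupp.linearCombination_apply, Finsupp.sum, map_sum, map_smul]
    rfl

lemma isClosed_toWeakSpace_image {A : Set H} (hA : Convex ℝ A) (hAc : IsClosed A) :
    IsClosed (toWeakSpace ℝ H '' A) := by
  rw [← hAc.closure_eq, hA.toWeakSpace_closure ℝ]
  exact isClosed_closure

/-- Limits of forward convex combinations of selections of a weakly upper semicontinuous map. -/
lemma UpperSemicontinuousWeak.mem_of_tendsto {G : H → Set H} (hG : UpperSemicontinuousWeak G)
    {x : H} (hconv : Convex ℝ (G x)) (hclosed : IsClosed (G x)) {z : ℕ → H}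
    (hz : Tendsto z atTop (𝓝 x)) {p : ℕ → H} (hp : ∀ i, p i ∈ G (z i)) {W : ℕ → ℕ →₀ ℝ}
    (hW : ∀ n, W n ∈ tailWeights n) {g : H}
    (hg : Tendsto (fun n => Finsupp.linearCombination ℝ p (W n)) atTop (𝓝 g)) : g ∈ G x := by
  by_contra hgx
  obtain ⟨ξ, u, hlt, hug⟩ := geometric_hahn_banach_closed_point hconv hclosed hgx
  -- The half-space beyond the separating hyperplane is weakly closed and misses `G x`; by
  -- semicontinuity it misses `G (z i)` for late `i`, which confines `p i` to the opposite side.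
  have hcl := hG {y | u ≤ ξ y} (isClosed_toWeakSpace_image
    (convex_halfSpace_ge ξ.toLinearMap.isLinear u) (isClosed_le continuous_const ξ.continuous))
  have hx : x ∈ {y | (G y ∩ {y | u ≤ ξ y}).Nonempty}ᶜ := by
    rintro ⟨y, hy, huy⟩
    exact (hlt y hy).not_ge huy
  have hev : ∀ᶠ i in atTop, p i ∈ {y | ξ y ≤ u} := by
    filter_upwards [hz.eventually (hcl.isOpen_compl.mem_nhds hx)] with i hi
    by_contra hpi
    exact hi ⟨p i, hp i, (not_le.1 hpi).le⟩
  exact hug.not_ge (mem_of_tendsto_linearCombination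
    (convex_halfSpace_le ξ.toLinearMap.isLinear u)
    (isClosed_le ξ.continuous continuous_const) hev hW hg)

/-- Limits of forward convex combinations of approximate proximal normals are Clarke normals. -/
lemma mem_clarkeNormalCone_of_tendsto {C : Set H} {x : H} (hxC : x ∈ C) {y : ℕ → H}
    (hyC : ∀ i, y i ∈ C) (hy : Tendsto y atTop (𝓝 x)) {τ : ℕ → ℝ} (hτ : ∀ i, 0 < τ i)
    (hτ0 : Tendsto τ atTop (𝓝 0)) {a : ℕ → ℝ} (ha : Tendsto a atTop (𝓝 0)) {p : ℕ → H} {M : ℝ}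
    (hpM : ∀ i, ‖p i‖ ≤ M)
    (hp : ∀ i w, y i + τ i • w ∈ C → ⟪p i, w⟫ ≤ a i * (‖w‖ ^ 2 + 1)) {W : ℕ → ℕ →₀ ℝ}
    (hW : ∀ n, W n ∈ tailWeights n) {g : H}
    (hg : Tendsto (fun n => Finsupp.linearCombination ℝ p (W n)) atTop (𝓝 g)) :
    g ∈ clarkeNormalCone C x := by
  refine ⟨hxC, fun v hv => ?_⟩
  obtain ⟨w, hw, hwC⟩ := hv y τ hyC hy hτ hτ0
  -- Only the directions `w i` lead back into `C`; replacing them by `v` costs at most M‖v - w i‖.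
  have hle : ∀ i, ⟪p i, v⟫ ≤ a i * (‖w i‖ ^ 2 + 1) + M * ‖v - w i‖ := fun i => by
    have h1 : ⟪p i, v⟫ = ⟪p i, w i⟫ + ⟪p i, v - w i⟫ := by rw [← inner_add_right, add_sub_cancel]
    have h2 : ⟪p i, v - w i⟫ ≤ M * ‖v - w i‖ := (real_inner_le_norm _ _).trans
      (mul_le_mul_of_nonneg_right (hpM i) (norm_nonneg _))
    linarith [hp i (w i) (hwC i)]
  have hlim : Tendsto (fun i => a i * (‖w i‖ ^ 2 + 1) + M * ‖v - w i‖) atTop (𝓝 0) := by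
    simpa using (ha.mul ((hw.norm.pow 2).add_const 1)).add ((hw.const_sub v).norm.const_mul M)
  refine le_of_forall_pos_le_add fun δ hδ => ?_
  rw [zero_add]
  refine mem_of_tendsto_linearCombination (S := {g | ⟪g, v⟫ ≤ δ}) ?_ ?_ ?_ hW hg
  · exact convex_halfSpace_le ⟨fun a b => inner_add_left a b v,
      fun c a => by simp [inner_smul_left]⟩ δ
  · exact isClosed_le (continuous_id.inner continuous_const) continuous_const
  · filter_upwards [hlim.eventually_lt_const hδ] with i hi
    exact (hle i).trans hi.le

end Limit


/-! ### Integral representation and derivative of the limit curve -/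

section LimitIntegral

variable {E : Type*} [NormedAddCommGroup E] [NormedSpace ℝ E]

lemma linearCombination_const_add {n : ℕ} {w : ℕ →₀ ℝ} (hw : w ∈ tailWeights n) (x₀ : E)
    (b : ℕ → E) : Finsupp.linearCombination ℝ (fun i => x₀ + b i) w =
      x₀ + Finsupp.linearCombination ℝ b w := by
  have h1 := hw.2.2
  simp only [Finsupp.linearCombination_apply, Finsupp.sum, smul_eq_mul, mul_one] at h1
  simp only [Finsupp.linearCombination_apply, Finsupp.sum, smul_add, Finset.sum_add_distrib,
    ← Finset.sum_smul, h1, one_smul]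

lemma linearCombination_integral {v : ℕ → ℝ → E} {a b : ℝ}
    (hv : ∀ i, IntervalIntegrable (v i) volume a b) (w : ℕ →₀ ℝ) :
    Finsupp.linearCombination ℝ (fun i => ∫ s in a..b, v i s) w =
      ∫ s in a..b, Finsupp.linearCombination ℝ (fun i => v i s) w := by
  simp only [Finsupp.linearCombination_apply, Finsupp.sum]
  rw [intervalIntegral.integral_finsetSum (f := fun i s => w i • v i s)
    fun i _ => (hv i).smul (w i)]
  simp only [intervalIntegral.integral_smul]

lemma aestronglyMeasurable_linearCombination {α : Type*} {mα : MeasurableSpace α} {μ : Measure α}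
    {v : ℕ → α → E} (hv : ∀ i, AEStronglyMeasurable (v i) μ) (w : ℕ →₀ ℝ) :
    AEStronglyMeasurable (fun s => Finsupp.linearCombination ℝ (fun i => v i s) w) μ := by
  simp only [Finsupp.linearCombination_apply, Finsupp.sum]
  exact Finset.aestronglyMeasurable_fun_sum _ fun i _ => (hv i).const_smul (w i)

variable {T : ℝ} {v : ℕ → ℝ → E} {M : ℝ} {W : ℕ → ℕ →₀ ℝ} {g : ℝ → E}

lemma ae_norm_linearCombination_le {α : Type*} {mα : MeasurableSpace α} {μ : Measure α}
    {v : ℕ → α → E} (hM : ∀ i, ∀ᵐ s ∂μ, ‖v i s‖ ≤ M) (hW : ∀ n, W n ∈ tailWeights n) :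
    ∀ᵐ s ∂μ, ∀ n, ‖Finsupp.linearCombination ℝ (fun i => v i s) (W n)‖ ≤ M := by
  filter_upwards [ae_all_iff.2 hM] with s hs n
  simpa using linearCombination_mem_of_tailWeights (convex_closedBall (0 : E) M)
    (b := fun i => v i s) (fun i _ => by simpa using hs i) (hW n)

lemma integrable_of_ae_tendsto_linearCombination {α : Type*} {mα : MeasurableSpace α}
    {μ : Measure α} [IsFiniteMeasure μ] {v : ℕ → α → E} {g : α → E}
    (hv : ∀ i, AEStronglyMeasurable (v i) μ) (hM : ∀ i, ∀ᵐ s ∂μ, ‖v i s‖ ≤ M)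
    (hW : ∀ n, W n ∈ tailWeights n)
    (hg : ∀ᵐ s ∂μ, Tendsto (fun n => Finsupp.linearCombination ℝ (fun i => v i s) (W n)) atTop
      (𝓝 (g s))) : Integrable g μ ∧ ∀ᵐ s ∂μ, ‖g s‖ ≤ M := by
  have hb : ∀ᵐ s ∂μ, ‖g s‖ ≤ M := by
    filter_upwards [hg, ae_norm_linearCombination_le hM hW] with s h1 h2
    exact le_of_tendsto h1.norm (Eventually.of_forall h2)
  exact ⟨Integrable.of_bound (aestronglyMeasurable_of_tendsto_ae atTop
    (fun n => aestronglyMeasurable_linearCombination hv (W n)) hg) M hb, hb⟩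

lemma eq_integral_of_ae_tendsto_linearCombination {x : ℕ → ℝ → E} {y : ℝ → E} {x₀ : E}
    (hx : ∀ i, ∀ t ∈ Icc 0 T, x i t = x₀ + ∫ s in (0)..t, v i s)
    (hv : ∀ i, AEStronglyMeasurable (v i) (volume.restrict (Icc 0 T)))
    (hM : ∀ i, ∀ᵐ s ∂(volume.restrict (Icc 0 T)), ‖v i s‖ ≤ M)
    (hy : ∀ t ∈ Icc 0 T, Tendsto (fun i => x i t) atTop (𝓝 (y t)))
    (hW : ∀ n, W n ∈ tailWeights n)
    (hg : ∀ᵐ s ∂(volume.restrict (Icc 0 T)),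
      Tendsto (fun n => Finsupp.linearCombination ℝ (fun i => v i s) (W n)) atTop (𝓝 (g s)))
    {t : ℝ} (ht : t ∈ Icc 0 T) : y t = x₀ + ∫ s in (0)..t, g s := by
  have hsub : uIoc 0 t ⊆ Icc 0 T := by
    rw [uIoc_of_le ht.1]
    exact Ioc_subset_Icc_self.trans (Icc_subset_Icc_right ht.2)
  have hint : ∀ i, IntervalIntegrable (v i) volume 0 t := fun i =>
    (intervalIntegrable_iff_integrableOn_Icc_of_le ht.1).2
      (IntegrableOn.mono_set (Integrable.of_bound (hv i) M (hM i)) (Icc_subset_Icc_right ht.2))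
  have h1 : Tendsto (fun n => Finsupp.linearCombination ℝ (fun i => x i t) (W n)) atTop (𝓝 (y t)) :=
    tendsto_linearCombination (hy t ht) hW
  have h2 : ∀ n, Finsupp.linearCombination ℝ (fun i => x i t) (W n) =
      x₀ + ∫ s in (0)..t, Finsupp.linearCombination ℝ (fun i => v i s) (W n) := fun n => by
    simp only [hx _ t ht]
    rw [linearCombination_const_add (hW n), linearCombination_integral hint]
  simp only [h2] at h1
  -- The same combinations of the curves converge to `y t`; under the integral, dominated
  -- convergence applies with the constant `M`.
  refine tendsto_nhds_unique h1 (tendsto_const_nhds.add ?_)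
  refine intervalIntegral.tendsto_integral_filter_of_dominated_convergence (fun _ => M)
    (Eventually.of_forall fun n => ?_) (Eventually.of_forall fun n => ?_)
    intervalIntegrable_const ?_
  · exact (aestronglyMeasurable_linearCombination hv (W n)).mono_measure
      (Measure.restrict_mono hsub le_rfl)
  · filter_upwards [(ae_restrict_iff' measurableSet_Icc).1 (ae_norm_linearCombination_le hM hW)]
      with s hs hs'
    exact hs (hsub hs') n
  · filter_upwards [(ae_restrict_iff' measurableSet_Icc).1 hg] with s hs hs'
    exact hs (hsub hs')

lemma ae_hasDerivAt_of_eq_integral [CompleteSpace E] (hT : 0 ≤ T) {y : ℝ → E} {x₀ : E}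
    (hg : IntegrableOn g (Icc 0 T)) (hy : ∀ t ∈ Icc 0 T, y t = x₀ + ∫ s in (0)..t, g s) :
    ∀ᵐ t ∂(volume.restrict (Icc 0 T)), HasDerivAt y (g t) t := by
  have hI : IntervalIntegrable g volume 0 T :=
    (intervalIntegrable_iff_integrableOn_Icc_of_le hT).2 hg
  have h0 : ∀ᵐ t : ℝ, t ≠ 0 := by simp [ae_iff, measure_singleton]
  have h1 : ∀ᵐ t : ℝ, t ≠ T := by simp [ae_iff, measure_singleton]
  rw [ae_restrict_iff' measurableSet_Icc]
  filter_upwards [hI.ae_hasDerivAt_integral, h0, h1] with t ht ht0 htT htI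
  rw [uIcc_of_le hT] at ht
  have hd := (ht htI 0 ⟨le_rfl, hT⟩).const_add x₀
  refine hd.congr_of_eventuallyEq ?_
  -- The formula for `y` holds only on [0, T], so differentiating it requires an interior point.
  filter_upwards [Icc_mem_nhds (lt_of_le_of_ne htI.1 ht0.symm) (lt_of_le_of_ne htI.2 htT)]
    with s hs using hy s hs

end LimitIntegral


/-! ### Bounds uniform in the step size -/

section UniformEstimates

lemma ae_mem_Ioc (T : ℝ) : ∀ᵐ s ∂(volume.restrict (Icc 0 T)), s ∈ Ioc 0 T := by
  have h0 : ∀ᵐ t : ℝ, t ≠ 0 := by simp [ae_iff, measure_singleton]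
  filter_upwards [ae_restrict_mem measurableSet_Icc, ae_restrict_of_ae h0] with s hs hs0
  exact ⟨lt_of_le_of_ne hs.1 hs0.symm, hs.2⟩

variable {H : Type*} [NormedAddCommGroup H] [InnerProductSpace ℝ H]
variable {T : ℝ} {C : Set H} {f : ℝ → H → H} {x₀ : H} {n : ℕ} {c : H → ℝ} {M : ℝ}

lemma exists_uniform_bounds [CompleteSpace H] (hT : 0 < T) (hx₀ : x₀ ∈ C) (hc0 : 0 ≤ c x₀)
    {L : ℝ≥0} (hcL : LipschitzWith L c)
    (hc : ∀ y, ∀ᵐ t ∂(volume.restrict (Icc 0 T)), ‖f t y‖ ≤ c y) {ε : ℕ → ℝ}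
    (hε : ∀ n, 1 ≤ n → 0 < ε n)
    (hε_lim : Tendsto (fun n : ℕ => √(ε n / (T / n) ^ 2)) atTop (𝓝 0))
    {node : ℕ → ℕ → H} {xs : ℕ → ℝ → H}
    (hxs : ∀ n, 1 ≤ n → IsCatchingUpIterate T C f x₀ n (ε n) (node n) (xs n)) :
    ∃ R M : ℝ, 0 < R ∧ 0 ≤ M ∧ ∀ n, 1 ≤ n → (∀ k ≤ n, ‖node n k‖ ≤ R) ∧
      ∀ k < n, c (node n k) ≤ M ∧ ‖correction T f n (node n) k‖ ≤ M := by
  obtain ⟨M₀, hM₀⟩ := hε_lim.bddAbove_range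
  have hM₀' : ∀ n, √(ε n / (T / (n : ℕ)) ^ 2) ≤ M₀ := fun n => hM₀ (mem_range_self n)
  have hM₀0 : 0 ≤ M₀ := (Real.sqrt_nonneg _).trans (hM₀' 0)
  set R := (2 * c x₀ + M₀) * Real.exp ((2 * L + 1) * T) with hR
  have hR0 : 0 ≤ R := by positivity
  refine ⟨‖x₀‖ + R + 1, c x₀ + L * R + M₀, by positivity, by positivity, fun n hn => ?_⟩
  have hnode : ∀ k ≤ n, ‖node n k - x₀‖ ≤ R := fun k hk =>
    IsCatchingUpIterate.norm_node_sub_le hT hx₀ hc0 hcL hc hn (hε n hn).le (hM₀' n) (hxs n hn) hk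
  have hcnode : ∀ k ≤ n, c (node n k) ≤ c x₀ + L * R := fun k hk => by
    have h1 := hcL.dist_le_mul (node n k) x₀
    rw [Real.dist_eq, dist_eq_norm] at h1
    have h2 := mul_le_mul_of_nonneg_left (hnode k hk) L.coe_nonneg
    linarith [le_abs_self (c (node n k) - c x₀)]
  refine ⟨fun k hk => ?_, fun k hk => ⟨?_, ?_⟩⟩
  · have := norm_le_norm_add_norm_sub' (node n k) x₀
    linarith [hnode k hk]
  · linarith [hcnode k hk.le]
  · have := (hxs n hn).norm_correction_le hT hn (hε n hn).le hx₀ hk (hc _)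
    linarith [hcnode k hk.le, hM₀' n]

/-- The exceptional null set depends on the state, but only countably many nodes occur. -/
lemma ae_norm_drift_le {H : Type*} [NormedAddCommGroup H] {f : ℝ → H → H} {c : H → ℝ}
    (hc : ∀ y, ∀ᵐ t ∂(volume.restrict (Icc 0 T)), ‖f t y‖ ≤ c y) (n : ℕ) (node : ℕ → H) :
    ∀ᵐ s ∂(volume.restrict (Icc 0 T)),
      ‖f s (node (gridIndex T n s))‖ ≤ c (node (gridIndex T n s)) := by
  filter_upwards [ae_all_iff.2 fun k => hc (node k)] with s hs using hs _

/-- The distance between a Lipschitz catching-up iterate and the neighbouring discrete states is of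
the order of the step size. -/
lemma dist_node_le {H : Type*} [NormedAddCommGroup H] (hT : 0 < T) (hn : 1 ≤ n)
    {node : ℕ → H} {x : ℝ → H}
    (hnode : ∀ k ≤ n, node k = x (gridPoint T n k)) {L : ℝ≥0} (hL : LipschitzOnWith L x (Icc 0 T))
    {t : ℝ} (ht : t ∈ Ioc 0 T) :
    dist (x t) (node (gridIndex T n t)) ≤ L * (T / n) ∧
      dist (x t) (node (gridIndex T n t + 1)) ≤ L * (T / n) := by
  obtain ⟨hk, h1, h2⟩ := gridIndex_spec hT hn ht
  rw [hnode _ hk.le, hnode _ hk]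
  have hs := gridPoint_succ T n (gridIndex T n t)
  refine ⟨(hL.dist_le_mul _ (Ioc_subset_Icc_self ht) _ (gridPoint_mem hT hn hk.le)).trans ?_,
    (hL.dist_le_mul _ (Ioc_subset_Icc_self ht) _ (gridPoint_mem hT hn hk)).trans ?_⟩
  all_goals
    refine mul_le_mul_of_nonneg_left ?_ L.coe_nonneg
    rw [Real.dist_eq, abs_le]
    constructor <;> linarith

end UniformEstimates

end Sweeping

/-! ### Convergence of the catching-up algorithm -/

open Sweeping

theorem theorem6p1 {H : Type*} [NormedAddCommGroup H] [InnerProductSpace ℝ H] [CompleteSpace H]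
    (T : ℝ) (hT : 0 < T)
    (C : Set H) (hC : Sweeping.BallCompact C)
    (F : ℝ → H → Set H)
    (hF_nonempty : ∀ t ∈ Icc 0 T, ∀ x, (F t x).Nonempty)
    (hF_closed : ∀ t ∈ Icc 0 T, ∀ x, IsClosed (F t x))
    (hF_convex : ∀ t ∈ Icc 0 T, ∀ x, Convex ℝ (F t x))
    (hF_usc : ∀ t ∈ Icc 0 T, Sweeping.UpperSemicontinuousWeak (F t))
    (h : H → ℝ) (hh_nonneg : ∀ x, 0 ≤ h x)
    (Lh : ℝ≥0) (hh_lip : LipschitzWith Lh h)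
    (hF_growth : ∀ x, ∀ᵐ t ∂(volume.restrict (Icc 0 T)), Metric.infDist 0 (F t x) ≤ h x)
    (γ : ℝ) (hγ : 0 < γ)
    (f : ℝ → H → H)
    (hf_sel : ∀ t ∈ Icc 0 T, ∀ x, f t x ∈ Sweeping.approxProj γ (F t x) 0)
    (hf_meas : ∀ x, AEStronglyMeasurable (fun t => f t x) (volume.restrict (Icc 0 T)))
    (x₀ : H) (hx₀ : x₀ ∈ C)
    (ε : ℕ → ℝ) (hε_pos : ∀ n, 1 ≤ n → 0 < ε n)
    (hε_lim : Tendsto (fun n : ℕ => ε n / (T / n) ^ 2) atTop (𝓝 0))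
    (node : ℕ → ℕ → H) (xs : ℕ → ℝ → H)
    (hxs : ∀ n, 1 ≤ n → Sweeping.IsCatchingUpIterate T C f x₀ n (ε n) (node n) (xs n)) :
    ∃ (φ : ℕ → ℕ) (x : ℝ → H), StrictMono φ ∧
      TendstoUniformlyOn (fun j => xs (φ j)) x atTop (Icc 0 T) ∧
      Sweeping.IsLipschitzSolution T C F x₀ x ∧
      ∀ᵐ t ∂(volume.restrict (Icc 0 T)), ‖deriv x t‖ ≤ 2 * (h (x t) + √γ) := by
  -- estimates that are uniform in the step size
  set c : H → ℝ := fun y => h y + √γ with hcdef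
  have hcL : LipschitzWith Lh c := by
    simpa using hh_lip.add (LipschitzWith.const √γ)
  have hc0 : ∀ y, 0 ≤ c y := fun y => add_nonneg (hh_nonneg y) (Real.sqrt_nonneg γ)
  have hc : ∀ y, ∀ᵐ t ∂(volume.restrict (Icc 0 T)), ‖f t y‖ ≤ c y := fun y => by
    filter_upwards [hF_growth y, ae_restrict_mem measurableSet_Icc] with t ht htI
    simpa using norm_sub_le_of_mem_approxProj hγ.le (hf_sel t htI y) ht
  have hfint : ∀ y, IntegrableOn (fun t => f t y) (Icc 0 T) := fun y =>
    Integrable.of_bound (hf_meas y) (c y) (hc y)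
  set e : ℕ → ℝ := fun n => √(ε n / (T / n) ^ 2) with hedef
  have he : Tendsto e atTop (𝓝 0) := by simpa using hε_lim.sqrt
  obtain ⟨R, M, hR, hM, hbd⟩ := exists_uniform_bounds hT hx₀ (hc0 x₀) hcL hc hε_pos he hxs
  have hdrift : ∀ n, 1 ≤ n → ∀ᵐ s ∂(volume.restrict (Icc 0 T)),
      ‖f s (node n (gridIndex T n s))‖ ≤ M := fun n hn => by
    filter_upwards [ae_norm_drift_le hc n (node n), ae_mem_Ioc T] with s hs hsI
    exact hs.trans ((hbd n hn).2 _ (gridIndex_spec hT hn hsI).1).1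
  have hcorr : ∀ n, 1 ≤ n → ∀ᵐ s ∂(volume.restrict (Icc 0 T)),
      ‖correction T f n (node n) (gridIndex T n s)‖ ≤ M := fun n hn => by
    filter_upwards [ae_mem_Ioc T] with s hsI
    exact ((hbd n hn).2 _ (gridIndex_spec hT hn hsI).1).2
  set L : ℝ≥0 := ⟨M + M, by positivity⟩ with hLdef
  have hvel : ∀ n, 1 ≤ n → ∀ᵐ s ∂(volume.restrict (Icc 0 T)),
      ‖velocity T f n (node n) s‖ ≤ L := fun n hn => by
    filter_upwards [hdrift n hn, hcorr n hn] with s h1 h2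
    exact (norm_add_le _ _).trans (add_le_add h1 h2)
  have hvm : ∀ n, AEStronglyMeasurable (velocity T f n (node n)) (volume.restrict (Icc 0 T)) :=
    fun n => (aestronglyMeasurable_drift hf_meas n (node n)).add
      (aestronglyMeasurable_correction n (node n))
  have hvint : ∀ n, 1 ≤ n → IntegrableOn (velocity T f n (node n)) (Icc 0 T) := fun n hn =>
    Integrable.of_bound (hvm n) L (hvel n hn)
  have hrep : ∀ n, 1 ≤ n → ∀ t ∈ Icc 0 T,
      xs n t = x₀ + ∫ s in (0)..t, velocity T f n (node n) s := fun n hn t ht =>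
    (hxs n hn).eq_integral hT hn hfint (hvint n hn) ht
  have hlip : ∀ n, 1 ≤ n → LipschitzOnWith L (xs n) (Icc 0 T) := fun n hn =>
    lipschitzOnWith_of_eq_integral (hrep n hn) (hvint n hn) (hvel n hn)
  have hdist : ∀ n, 1 ≤ n → ∀ t ∈ Ioc 0 T,
      dist (xs n t) (node n (gridIndex T n t)) ≤ L * (T / n) ∧
        dist (xs n t) (node n (gridIndex T n t + 1)) ≤ L * (T / n) := fun n hn t ht =>
    dist_node_le hT hn (fun k hk => (hxs n hn).node_eq hT hn hfint (hvint n hn) hk) (hlip n hn) ht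
  have hstep : Tendsto (fun n : ℕ => L * (T / n)) atTop (𝓝 0) := by
    simpa using (tendsto_const_div_atTop_nhds_zero_nat T).const_mul (L : ℝ)
  -- extraction of a uniformly convergent subsequence
  obtain ⟨ψ, x, hψ, hunif⟩ := exists_subseq_tendstoUniformlyOn (a := 0) (b := T)
    (x := fun m => xs (m + 1)) (L := L) (fun m => hlip (m + 1) (by omega)) (hC R hR)
    (hstep.comp (tendsto_add_atTop_nat 1)) (fun m t ht => by
      have hn : 1 ≤ m + 1 := by omega
      -- Time 0 belongs to no half-open cell, so it is compared with the initial node directly.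
      rcases ht.1.eq_or_lt with rfl | h0
      · refine ⟨node (m + 1) 0, ⟨(hxs _ hn).node_mem hx₀ 0 (by omega), ?_⟩, ?_⟩
        · simpa using (hbd _ hn).1 0 (by omega)
        · rw [(hxs _ hn).initial, (hxs _ hn).node_zero, dist_self]
          simp only [Function.comp_apply]
          positivity
      · have hk := (gridIndex_spec hT hn ⟨h0, ht.2⟩).1.le
        exact ⟨_, ⟨(hxs _ hn).node_mem hx₀ _ hk, by simpa using (hbd _ hn).1 _ hk⟩,
          (hdist _ hn t ⟨h0, ht.2⟩).1⟩)
  set φ : ℕ → ℕ := fun j => ψ j + 1 with hφdef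
  have hφ1 : ∀ j, 1 ≤ φ j := fun j => Nat.le_add_left 1 _
  have hφ : StrictMono φ := fun i j hij => Nat.add_lt_add_right (hψ hij) 1
  have hφt := hφ.tendsto_atTop
  -- almost everywhere convergence of convex combinations of the derivatives
  obtain ⟨W, hW, p, q, hp, hq⟩ := exists_ae_tendsto_linearCombination_prod
    (p := fun j s => f s (node (φ j) (gridIndex T (φ j) s)))
    (q := fun j s => correction T f (φ j) (node (φ j)) (gridIndex T (φ j) s))
    (fun j => aestronglyMeasurable_drift hf_meas (φ j) (node (φ j)))
    (fun j => aestronglyMeasurable_correction (φ j) (node (φ j)))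
    (fun j => hdrift (φ j) (hφ1 j)) (fun j => hcorr (φ j) (hφ1 j))
  have hpq : ∀ᵐ s ∂(volume.restrict (Icc 0 T)), Tendsto (fun n => Finsupp.linearCombination ℝ
      (fun j => velocity T f (φ j) (node (φ j)) s) (W n)) atTop (𝓝 (p s + q s)) := by
    filter_upwards [hp, hq] with s h1 h2
    refine (h1.add h2).congr fun n => ?_
    simp only [Finsupp.linearCombination_apply, Finsupp.sum, velocity, smul_add,
      Finset.sum_add_distrib]
  have hpt : ∀ t ∈ Icc 0 T, Tendsto (fun j => xs (φ j) t) atTop (𝓝 (x t)) := fun t ht =>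
    hunif.tendsto_at ht
  obtain ⟨hgint, hgbd⟩ := integrable_of_ae_tendsto_linearCombination
    (fun j => hvm (φ j)) (fun j => hvel (φ j) (hφ1 j)) hW hpq
  have hxint : ∀ t ∈ Icc 0 T, x t = x₀ + ∫ s in (0)..t, (p s + q s) := fun t ht =>
    eq_integral_of_ae_tendsto_linearCombination (fun j => hrep (φ j) (hφ1 j))
      (fun j => hvm (φ j)) (fun j => hvel (φ j) (hφ1 j)) hpt hW hpq ht
  have hderiv := ae_hasDerivAt_of_eq_integral hT.le hgint hxint
  have hnode0 : ∀ t ∈ Ioc 0 T,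
      Tendsto (fun j => node (φ j) (gridIndex T (φ j) t)) atTop (𝓝 (x t)) := fun t ht =>
    (tendsto_iff_of_dist (squeeze_zero (fun _ => dist_nonneg)
      (fun j => (hdist (φ j) (hφ1 j) t ht).1) (hstep.comp hφt))).1 (hpt t (Ioc_subset_Icc_self ht))
  have hnode1 : ∀ t ∈ Ioc 0 T,
      Tendsto (fun j => node (φ j) (gridIndex T (φ j) t + 1)) atTop (𝓝 (x t)) := fun t ht =>
    (tendsto_iff_of_dist (squeeze_zero (fun _ => dist_nonneg)
      (fun j => (hdist (φ j) (hφ1 j) t ht).2) (hstep.comp hφt))).1 (hpt t (Ioc_subset_Icc_self ht))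
  -- √ε_n is the product of the vanishing ratio √ε_n/μ_n and the step μ_n.
  have hsqrt : Tendsto (fun j => √(ε (φ j))) atTop (𝓝 0) := by
    have h1 : Tendsto (fun j => e (φ j) * (T / (φ j : ℕ))) atTop (𝓝 0) := by
      have := (he.mul (tendsto_const_div_atTop_nhds_zero_nat T)).comp hφt
      rwa [mul_zero] at this
    refine h1.congr fun j => ?_
    have hμ : 0 < T / (φ j : ℕ) := by have := hφ1 j; positivity
    rw [hedef]
    simp only
    rw [Real.sqrt_div' _ (sq_nonneg _), Real.sqrt_sq hμ.le, div_mul_cancel₀ _ hμ.ne']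
  refine ⟨φ, x, hφ, hunif, ⟨⟨L, lipschitzOnWith_of_eq_integral hxint hgint hgbd⟩, ?_, ?_⟩, ?_⟩
  · simpa using hxint 0 ⟨le_rfl, hT.le⟩
  · filter_upwards [hderiv, hp, hq, ae_mem_Ioc T] with t hd hpt' hqt ht
    have htI := Ioc_subset_Icc_self ht
    have hidx : ∀ j, gridIndex T (φ j) t < φ j := fun j => (gridIndex_spec hT (hφ1 j) ht).1
    -- The normals are based at the right-hand nodes, where the projections land, while `F` is
    -- evaluated at the left-hand ones; both converge to `x t`.
    have hyC : ∀ j, node (φ j) (gridIndex T (φ j) t + 1) ∈ C := fun j =>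
      (hxs _ (hφ1 j)).node_mem hx₀ _ (hidx j)
    refine ⟨hd.differentiableAt, ?_⟩
    rw [hd.deriv, add_comm (p t)]
    refine Set.add_mem_add (Set.mem_neg.2 ?_) ?_
    -- With τ = √ε the error (τ‖w‖² + ε/τ)/(2μ) becomes (√ε/(2μ))(‖w‖² + 1), whence a = e/2.
    · refine mem_clarkeNormalCone_of_tendsto
        (hC.isClosed.mem_of_tendsto (hnode1 t ht) (Eventually.of_forall hyC)) hyC (hnode1 t ht)
        (τ := fun j => √(ε (φ j))) (fun j => Real.sqrt_pos.2 (hε_pos _ (hφ1 j))) hsqrt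
        (a := fun j => e (φ j) / 2) (by simpa using (he.comp hφt).div_const 2)
        (p := fun j => -correction T f (φ j) (node (φ j)) (gridIndex T (φ j) t)) (M := M)
        (fun j => by rw [norm_neg]; exact ((hbd _ (hφ1 j)).2 _ (hidx j)).2) (fun j w hw => ?_) hW ?_
      · have hμ : 0 < T / (φ j : ℕ) := by have := hφ1 j; positivity
        refine ((hxs _ (hφ1 j)).inner_correction_le hT (hφ1 j) (hidx j)
          (Real.sqrt_pos.2 (hε_pos _ (hφ1 j))) hw).trans_eq ?_
        rw [Real.div_sqrt, hedef]
        simp only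
        rw [Real.sqrt_div' _ (sq_nonneg _), Real.sqrt_sq hμ.le]
        field_simp
      · refine hqt.neg.congr fun n => ?_
        simp only [Finsupp.linearCombination_apply, Finsupp.sum, smul_neg, Finset.sum_neg_distrib]
    · exact (hF_usc t htI).mem_of_tendsto (hF_convex t htI _) (hF_closed t htI _) (hnode0 t ht)
        (fun j => (hf_sel t htI _).1) hW hpt'
  · filter_upwards [hderiv, hpq, ae_mem_Ioc T,
      ae_all_iff.2 fun j => ae_norm_drift_le hc (φ j) (node (φ j))] with t hd hpqt ht hdr
    rw [hd.deriv]
    -- The uniform bound `L` is too crude here: at time `t` the velocity is bounded through the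
    -- current node, and that bound converges to 2c(x(t)).
    have hlim : Tendsto (fun j => 2 * c (node (φ j) (gridIndex T (φ j) t)) + e (φ j)) atTop
        (𝓝 (2 * c (x t))) := by
      simpa using (((hcL.continuous.tendsto _).comp (hnode0 t ht)).const_mul 2).add (he.comp hφt)
    refine le_of_forall_pos_le_add fun δ hδ => ?_
    have := mem_of_tendsto_linearCombination (convex_closedBall (0 : H) (2 * c (x t) + δ))
      Metric.isClosed_closedBall ?_ hW hpqt
    · simpa using this
    · filter_upwards [hlim.eventually_lt_const (lt_add_of_pos_right _ hδ)] with j hj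
      rw [mem_closedBall_zero_iff]
      have h1 := (hxs _ (hφ1 j)).norm_correction_le hT (hφ1 j) (hε_pos _ (hφ1 j)).le hx₀
        (gridIndex_spec hT (hφ1 j) ht).1 (hc _)
      have h2 := norm_add_le (f t (node (φ j) (gridIndex T (φ j) t)))
        (correction T f (φ j) (node (φ j)) (gridIndex T (φ j) t))
      have h3 := hdr j
      change ‖velocity T f (φ j) (node (φ j)) t‖ ≤ _ at h2 ⊢
      have h4 : ‖correction T f (φ j) (node (φ j)) (gridIndex T (φ j) t)‖ ≤
        c (node (φ j) (gridIndex T (φ j) t)) + e (φ j) := h1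
      linarith
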